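/- Let $k\ge 0$ and let $R$ be a unique factorization domain (for instance $\mathbb{Z}$ or a field). A partition of length at most $k$ is written $\lambda=(\lambda_1\ge\dots\ge\lambda_k\ge 0)$; it has length exactly $k$ if all $k$ entries are positive. For partitions, $\mu\le\lambda$ means $\mu_i\le\lambda_i$ for all $i$. With variables $\mathbf{x}=(x_1,\dots,x_k)$, $\mathbf{y}=(y_1,\dots,y_k)$ define the formal power series over $R$ $$\tilde Q_k(\mathbf{x},\mathbf{y})=\sum_{\emptyset\le\mu\le\lambda,\ \lambda \text{ of length}\le k}\mathbf{x}^\lambda\mathbf{y}^\mu,\qquad Q_k(\mathbf{x},\mathbf{y})=\sum_{\emptyset\le\mu\le\lambda,\ \lambda\text{ of length exactly }k}\mathbf{x}^\lambda\mathbf{y}^\mu .$$ Let $C_k\subset\mathbb{R}^k\times\mathbb{R}^k$ be the cone of all $(\lambda,\mu)$ with $\lambda_i\ge\lambda_j$ and $\mu_i\ge\mu_j$ for $i<j$, and $\lambda_i\ge\mu_i$, $\lambda_i\ge0$, $\mu_i\ge 0$ for all $i$. Let $S_k$ be the set of points in which the extremal rays of $C_k$ meet the affine hyperplane $\lambda_1=1$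 (so $S_0=\emptyset$); $S_k$ is a finite set of nonnegative integer vectors. Put $$D_k=\prod_{\mathbf{r}\in S_k}\bigl(1-(\mathbf{x}\mathbf{y})^{\mathbf{r}}\bigr)\in R[\mathbf{x},\mathbf{y}],$$ where $(\mathbf{x}\mathbf{y})^{(\lambda,\mu)}=\mathbf{x}^\lambda\mathbf{y}^\mu$. Then: 1. The denominator of $\tilde Q_k$ in lowest terms is exactly $D_k$: there is a polynomial $\tilde N\in R[\mathbf{x},\mathbf{y}]$ with $\tilde Q_k\cdot D_k=\tilde N$, and $\tilde N$ and $D_k$ have no common factor in $R[\mathbf{x},\mathbf{y}]$ other than units. 2. The same holds for $Q_k$: there is a polynomial $N\in R[\mathbf{x},\mathbf{y}]$ with $Q_k\cdot D_k=N$, and $N$ and $D_k$ have no common factor other than units. 3. Under the specialization $y_1=\dots=y_k=y$, the series $Q_k(\mathbf{x},\mathbf{y})$ becomes $Q_k(\mathbf{x},y)=\sum_{\lambda}P_\lambda(y)\,\mathbf{x}^\lambda$, where $\lambda$ runs over the partitions of length exactly $k$ and $P_\lambda(y)=\sum_{\emptyset\le\mu\le\lambda}y^{|\mu|}$; the polynomial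 $D_k$ becomes $D_k(\mathbf{x},y)=\prod_{m=1}^k\prod_{j=0}^m\bigl(1-y^jx_1x_2\cdots x_m\bigr)$; and $Q_k(\mathbf{x},y)\cdot D_k(\mathbf{x},y)$ is a polynomial (Azam–Richmond, Proposition 15). -/

import Mathlib

noncomputable section

namespace TwoRowPP

/-! Coordinates of `ℝ^k × ℝ^k`, exponents, and variables are indexed by `Fin k ⊕ Fin k`:
`Sum.inl i` is the `i`-th coordinate of `λ` (variable `x_i`), and `Sum.inr i` is the `i`-th
coordinate of `μ` (variable `y_i`). -/

/-- The exponent `(λ, μ)` is a pair of partitions `∅ ≤ μ ≤ λ`, where `λ` has at most `k` parts. -/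
def IsPartitionPair {k : ℕ} (e : Fin k ⊕ Fin k →₀ ℕ) : Prop :=
  Antitone (fun i : Fin k => e (Sum.inl i)) ∧
  Antitone (fun i : Fin k => e (Sum.inr i)) ∧
  ∀ i : Fin k, e (Sum.inr i) ≤ e (Sum.inl i)

open Classical in
/-- `Q̃_k(x, y)`, the sum of `x^λ y^μ` over the pairs `∅ ≤ μ ≤ λ` where `λ` has length at most `k`. -/
def Qtilde (R : Type*) [CommRing R] (k : ℕ) : MvPowerSeries (Fin k ⊕ Fin k) R :=
  fun e => if IsPartitionPair e then 1 else 0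

open Classical in
/-- `Q_k(x, y)`, the sum of `x^λ y^μ` over the pairs `∅ ≤ μ ≤ λ` where `λ` has length exactly `k`,
that is, where all `k` parts of `λ` are positive. -/
def Q (R : Type*) [CommRing R] (k : ℕ) : MvPowerSeries (Fin k ⊕ Fin k) R :=
  fun e => if IsPartitionPair e ∧ ∀ i : Fin k, 0 < e (Sum.inl i) then 1 else 0

/-- The cone `C_k` in `ℝ^k × ℝ^k`. -/
def cone (k : ℕ) : PointedCone ℝ (Fin k ⊕ Fin k → ℝ) where
  carrier := {v |
    (∀ i j : Fin k, i < j → 0 ≤ v (Sum.inl i) - v (Sum.inl j)) ∧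
    (∀ i j : Fin k, i < j → 0 ≤ v (Sum.inr i) - v (Sum.inr j)) ∧
    (∀ i : Fin k, 0 ≤ v (Sum.inl i) - v (Sum.inr i)) ∧
    (∀ i : Fin k, 0 ≤ v (Sum.inl i)) ∧
    (∀ i : Fin k, 0 ≤ v (Sum.inr i))}
  add_mem' := by
    rintro a b ⟨a1, a2, a3, a4, a5⟩ ⟨b1, b2, b3, b4, b5⟩
    refine ⟨fun i j h => ?_, fun i j h => ?_, fun i => ?_, fun i => ?_, fun i => ?_⟩
    · have := a1 i j h; have := b1 i j h; simp only [Pi.add_apply]; linarith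
    · have := a2 i j h; have := b2 i j h; simp only [Pi.add_apply]; linarith
    · have := a3 i; have := b3 i; simp only [Pi.add_apply]; linarith
    · have := a4 i; have := b4 i; simp only [Pi.add_apply]; linarith
    · have := a5 i; have := b5 i; simp only [Pi.add_apply]; linarith
  zero_mem' := by simp
  smul_mem' := by
    rintro ⟨c, hc⟩ a ⟨a1, a2, a3, a4, a5⟩
    refine ⟨fun i j h => ?_, fun i j h => ?_, fun i => ?_, fun i => ?_, fun i => ?_⟩
    · have := mul_nonneg hc (a1 i j h)
      simp only [Pi.smul_apply, Nonneg.mk_smul, smul_eq_mul]; linarith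
    · have := mul_nonneg hc (a2 i j h)
      simp only [Pi.smul_apply, Nonneg.mk_smul, smul_eq_mul]; linarith
    · have := mul_nonneg hc (a3 i)
      simp only [Pi.smul_apply, Nonneg.mk_smul, smul_eq_mul]; linarith
    · exact mul_nonneg hc (a4 i)
    · exact mul_nonneg hc (a5 i)

/-- `v` spans an extremal ray of the cone `C`: it is nonzero, and the ray `ℝ_{≥0} v` is a face
of `C`. -/
def SpansExtremalRay {k : ℕ} (C : PointedCone ℝ (Fin k ⊕ Fin k → ℝ))
    (v : Fin k ⊕ Fin k → ℝ) : Prop :=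
  v ≠ 0 ∧ (PointedCone.hull ℝ {v}).IsFaceOf C

/-- The hyperplane `H`, given by `λ_1 = 1` (empty when `k = 0`). -/
def hyperplane (k : ℕ) : Set (Fin k ⊕ Fin k → ℝ) :=
  {v | ∃ h : 0 < k, v (Sum.inl ⟨0, h⟩) = 1}

/-- `S_k` as a set of real points: the intersections of the extremal rays of `C_k` with `H`. -/
def rayPoints (k : ℕ) : Set (Fin k ⊕ Fin k → ℝ) :=
  {v | SpansExtremalRay (cone k) v ∧ v ∈ hyperplane k}

/-- `S_k` as a set of exponents; by `exists_mem_S` below this omits no point of `rayPoints k`. -/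
def S (k : ℕ) : Set (Fin k ⊕ Fin k →₀ ℕ) :=
  {r | (fun i => (r i : ℝ)) ∈ rayPoints k}

theorem exists_mem_S {k : ℕ} {v : Fin k ⊕ Fin k → ℝ} (hv : v ∈ rayPoints k) :
    ∃ r ∈ S k, (∀ i, r i ≤ 1) ∧ v = fun i => (r i : ℝ) := by
  classical
  obtain ⟨⟨hv0, hface⟩, hk, h1⟩ := id hv
  have hvC : v ∈ cone k := hface.le (PointedCone.subset_hull rfl)
  obtain ⟨c1, c2, c3, c4, c5⟩ := id hvC
  have hnn : ∀ i, 0 ≤ v i := by rintro (i | i); exacts [c4 i, c5 i]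
  obtain ⟨ε, hε, hmin⟩ : ∃ ε : ℝ, 0 < ε ∧ ∀ i, 0 < v i → ε ≤ v i := by
    obtain ⟨i, hi, hmin⟩ := Finset.exists_min_image
      (Finset.univ.filter fun i => 0 < v i) v ⟨Sum.inl ⟨0, hk⟩, by simp [h1]⟩
    exact ⟨v i, (Finset.mem_filter.1 hi).2, fun j hj => hmin j (by simpa using hj)⟩
  let s : Fin k ⊕ Fin k → ℝ := fun i => if 0 < v i then 1 else 0
  have key : ∀ i j, 0 ≤ v i - v j →
      0 ≤ s i - s j ∧ 0 ≤ (v i - ε * s i) - (v j - ε * s j) := by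
    intro i j h
    have := hnn i
    have := hnn j
    by_cases hi : 0 < v i <;> by_cases hj : 0 < v j <;> simp only [s, hi, hj, if_true, if_false]
    · constructor <;> linarith
    · have := hmin i hi
      constructor <;> linarith
    · exact absurd (by linarith) hi
    · constructor <;> linarith
  have key0 : ∀ i, 0 ≤ s i ∧ 0 ≤ v i - ε * s i := by
    intro i
    have := hnn i
    by_cases hi : 0 < v i <;> simp only [s, hi, if_true, if_false]
    · have := hmin i hi
      constructor <;> linarith
    · constructor <;> linarith
  have hsC : s ∈ cone k :=
    ⟨fun i j h => (key _ _ (c1 i j h)).1, fun i j h => (key _ _ (c2 i j h)).1,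
      fun i => (key _ _ (c3 i)).1, fun i => (key0 _).1, fun i => (key0 _).1⟩
  have hyC : (fun i => v i - ε * s i) ∈ cone k :=
    ⟨fun i j h => (key _ _ (c1 i j h)).2, fun i j h => (key _ _ (c2 i j h)).2,
      fun i => (key _ _ (c3 i)).2, fun i => (key0 _).2, fun i => (key0 _).2⟩
  have hs : s ∈ PointedCone.hull ℝ {v} := by
    refine hface.mem_of_smul_add_mem hsC hyC hε ?_
    have : ε • s + (fun i => v i - ε * s i) = v := by
      funext i
      simp
    rw [this]
    exact PointedCone.subset_hull rfl
  obtain ⟨c, hc⟩ := Submodule.mem_span_singleton.1 hs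
  have hc' : ∀ i, (c : ℝ) * v i = s i := fun i => congrFun hc i
  have hc1 : (c : ℝ) = 1 := by
    have := hc' (Sum.inl ⟨0, hk⟩)
    simpa [s, h1] using this
  have hvs : v = fun i =>
      ((Finsupp.equivFunOnFinite.symm (fun i => if 0 < v i then 1 else 0) :
        Fin k ⊕ Fin k →₀ ℕ) i : ℝ) := by
    funext i
    have := hc' i
    rw [hc1, one_mul] at this
    rw [this]
    simp [s]
  refine ⟨Finsupp.equivFunOnFinite.symm (fun i => if 0 < v i then 1 else 0), ?_, ?_, hvs⟩
  · have := hv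
    rw [hvs] at this
    exact this
  · intro i
    simp only [Finsupp.equivFunOnFinite_symm_apply_apply]
    split_ifs <;> simp

theorem S_finite (k : ℕ) : (S k).Finite := by
  refine (Set.finite_Iic (Finsupp.equivFunOnFinite.symm fun _ => 1)).subset fun r hr => ?_
  obtain ⟨s, -, hs, h⟩ := exists_mem_S hr
  intro i
  have := congrFun h i
  have h2 : r i = s i := by exact_mod_cast this
  simpa [h2] using hs i

/-- `D_k`, the product of `1 - (xy)^r` over `r ∈ S_k`. -/
def D (R : Type*) [CommRing R] (k : ℕ) : MvPolynomial (Fin k ⊕ Fin k) R :=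
  ∏ r ∈ (S_finite k).toFinset, (1 - MvPolynomial.monomial r 1)

/-- `D` is the denominator in lowest terms of the power series `F`: `F = N / D` for a polynomial
`N` such that `N` and `D` have no common factor other than units. -/
def IsReducedDenominator {σ R : Type*} [CommRing R] (F : MvPowerSeries σ R)
    (D : MvPolynomial σ R) : Prop :=
  ∃ N : MvPolynomial σ R, F * (D : MvPowerSeries σ R) = (N : MvPowerSeries σ R) ∧ IsRelPrime N D

/-! The version in which `y` is a single variable: the variables are indexed by `Fin k ⊕ Unit`. -/

open Classical in
/-- `P_λ(y)`, the sum of `y^|μ|` over the partitions `μ` in the interval `[∅, λ]`. -/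
def P (R : Type*) [CommRing R] {k : ℕ} (lam : Fin k → ℕ) : Polynomial R :=
  ∑ μ ∈ (Finset.Iic lam).filter (fun μ => Antitone μ), Polynomial.X ^ (∑ i, μ i)

open Classical in
/-- `Q_k(x, y)`, the sum of `P_λ(y) x^λ` over the partitions `λ` of length exactly `k`. -/
def Qsingle (R : Type*) [CommRing R] (k : ℕ) : MvPowerSeries (Fin k ⊕ Unit) R :=
  fun e =>
    if Antitone (fun i : Fin k => e (Sum.inl i)) ∧ ∀ i : Fin k, 0 < e (Sum.inl i) then
      (P R (fun i : Fin k => e (Sum.inl i))).coeff (e (Sum.inr ()))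
    else 0

/-- `D_k(x, y)`, the product of `1 - y^j x_1 ⋯ x_m` over `1 ≤ m ≤ k` and `0 ≤ j ≤ m`. -/
def Dsingle (R : Type*) [CommRing R] (k : ℕ) : MvPolynomial (Fin k ⊕ Unit) R :=
  ∏ m ∈ Finset.Icc 1 k, ∏ j ∈ Finset.Icc 0 m,
    (1 - MvPolynomial.X (Sum.inr ()) ^ j *
      ∏ l ∈ Finset.univ.filter (fun l : Fin k => (l : ℕ) < m), MvPolynomial.X (Sum.inl l))

/-- The specialization `y_1 = ⋯ = y_k = y` on variables. -/
def collapse (k : ℕ) : Fin k ⊕ Fin k → Fin k ⊕ Unit :=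
  Sum.map id (fun _ => ())

end TwoRowPP

end

noncomputable section

namespace TwoRowPP

/-! ### The points of `S k` -/

/-! The points of `S k` are the nonzero partition pairs with entries in {0, 1}. Each nonzero pair
`e` has the same support as exactly one `r ∈ S k`, its indicator, and then `e - r` is again a pair,
supported inside the support of `r`. Hence the series of pairs supported in `r`, multiplied by 1 -
(xy)^r, is the series of pairs with strictly smaller support. Induction on the size of the support
gives a polynomial after multiplication by the factors of all `s ≤ r`; summing over `r` shows that
`D` is a denominator for every sum of pairs selected by their support, in particular for Q̃ and Q.

For lowest terms, each factor of `D` is irreducible, so it is enough that none divides the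
numerator. If the factor at `r` did, the series times the remaining factors would be a polynomial.
But there is a ray `e₀ + n • r` of exponents of the series, none of which is `t + a` with `a` an
exponent of the series and `t ∈ S k` other than `r`. The remaining factors leave the coefficients on
this ray equal to 1, and a polynomial has only finitely many nonzero coefficients.

Setting all y_i equal is a renaming of variables with finite fibres, so it carries the identity for
Q to the one-variable version. The product formula comes from the description of `S k` as the points
(1^m, 1^j) with 1 ≤ m ≤ k and j ≤ m. -/

theorem IsPartitionPair.add {k : ℕ} {a b : Fin k ⊕ Fin k →₀ ℕ} (ha : IsPartitionPair a)
    (hb : IsPartitionPair b) : IsPartitionPair (a + b) :=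
  ⟨ha.1.add hb.1, ha.2.1.add hb.2.1, fun i => add_le_add (ha.2.2 i) (hb.2.2 i)⟩

theorem IsPartitionPair.zero {k : ℕ} : IsPartitionPair (0 : Fin k ⊕ Fin k →₀ ℕ) :=
  ⟨fun _ _ _ => le_rfl, fun _ _ _ => le_rfl, fun _ => le_rfl⟩

theorem IsPartitionPair.nsmul {k : ℕ} {a : Fin k ⊕ Fin k →₀ ℕ} (ha : IsPartitionPair a) (n : ℕ) :
    IsPartitionPair (n • a) := by
  induction n with
  | zero => simpa using IsPartitionPair.zero
  | succ n ih => simpa [add_nsmul] using ih.add ha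

theorem IsPartitionPair.le_first {k : ℕ} {a : Fin k ⊕ Fin k →₀ ℕ} (ha : IsPartitionPair a)
    (hk : 0 < k) (s : Fin k ⊕ Fin k) : a s ≤ a (Sum.inl ⟨0, hk⟩) := by
  have h : ∀ i : Fin k, a (Sum.inl i) ≤ a (Sum.inl ⟨0, hk⟩) := fun i => ha.1 (Nat.zero_le _)
  rcases s with i | i
  · exact h i
  · exact (ha.2.2 i).trans (h i)

theorem le_first_of_mem_cone {k : ℕ} {z : Fin k ⊕ Fin k → ℝ} (hz : z ∈ cone k) (hk : 0 < k)
    (s : Fin k ⊕ Fin k) : 0 ≤ z s ∧ z s ≤ z (Sum.inl ⟨0, hk⟩) := by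
  obtain ⟨h1, -, h3, h4, h5⟩ := hz
  have h : ∀ i : Fin k, z (Sum.inl i) ≤ z (Sum.inl ⟨0, hk⟩) := by
    intro i
    rcases (Nat.zero_le (i : ℕ)).eq_or_lt with h0 | h0
    · have : i = ⟨0, hk⟩ := Fin.ext h0.symm
      rw [this]
    · linarith [h1 ⟨0, hk⟩ i h0]
  rcases s with i | i
  · exact ⟨h4 i, h i⟩
  · exact ⟨h5 i, by linarith [h3 i, h i]⟩

theorem natCast_mem_cone {k : ℕ} {r : Fin k ⊕ Fin k →₀ ℕ} :
    (fun i => (r i : ℝ)) ∈ cone k ↔ IsPartitionPair r := by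
  constructor
  · rintro ⟨h1, h2, h3, -, -⟩
    refine ⟨fun i j h => ?_, fun i j h => ?_, fun i => ?_⟩
    · rcases h.eq_or_lt with rfl | h
      · exact le_rfl
      · exact (Nat.cast_le (α := ℝ)).1 (sub_nonneg.1 (h1 i j h))
    · rcases h.eq_or_lt with rfl | h
      · exact le_rfl
      · exact (Nat.cast_le (α := ℝ)).1 (sub_nonneg.1 (h2 i j h))
    · exact (Nat.cast_le (α := ℝ)).1 (sub_nonneg.1 (h3 i))
  · rintro ⟨h1, h2, h3⟩
    refine ⟨fun i j h => sub_nonneg.2 ?_, fun i j h => sub_nonneg.2 ?_, fun i => sub_nonneg.2 ?_,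
      fun i => Nat.cast_nonneg _, fun i => Nat.cast_nonneg _⟩
    · exact Nat.cast_le.2 (h1 h.le)
    · exact Nat.cast_le.2 (h2 h.le)
    · exact Nat.cast_le.2 (h3 i)

theorem pos_of_ne_zero {k : ℕ} {r : Fin k ⊕ Fin k →₀ ℕ} (hr : r ≠ 0) : 0 < k := by
  obtain ⟨s, -⟩ := DFunLike.ne_iff.1 hr
  rcases s with i | i <;> exact i.pos

theorem IsPartitionPair.first_pos {k : ℕ} {r : Fin k ⊕ Fin k →₀ ℕ} (h : IsPartitionPair r)
    (hr : r ≠ 0) : 0 < r (Sum.inl ⟨0, pos_of_ne_zero hr⟩) := by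
  obtain ⟨s, hs⟩ := DFunLike.ne_iff.1 hr
  exact (Nat.pos_of_ne_zero hs).trans_le (h.le_first _ s)

/-- `S k` consists of the nonzero pairs of partitions with all parts at most one. -/
theorem mem_S_iff {k : ℕ} {r : Fin k ⊕ Fin k →₀ ℕ} :
    r ∈ S k ↔ IsPartitionPair r ∧ (∀ i, r i ≤ 1) ∧ r ≠ 0 := by
  constructor
  · intro hr
    have hr' : (fun i => (r i : ℝ)) ∈ rayPoints k := hr
    refine ⟨natCast_mem_cone.1 (hr'.1.2.le (PointedCone.subset_hull rfl)), ?_, ?_⟩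
    · obtain ⟨s, -, hs, h⟩ := exists_mem_S hr'
      intro i
      have h2 : r i = s i := by exact_mod_cast congrFun h i
      simpa [h2] using hs i
    · rintro rfl
      exact hr'.1.1 (by funext i; simp)
  · rintro ⟨hp, h1, h0⟩
    have hk := pos_of_ne_zero h0
    have hfirst : r (Sum.inl ⟨0, hk⟩) = 1 := le_antisymm (h1 _) (hp.first_pos h0)
    refine ⟨⟨fun h => ?_, ⟨?_, ?_⟩⟩, hk, by simp [hfirst]⟩
    · have := congrFun h (Sum.inl ⟨0, hk⟩)
      simp [hfirst] at this
    · exact Submodule.span_le.2 (by simpa using natCast_mem_cone.2 hp)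
    -- Extremality: suppose c r = a x + y with a > 0. Where `r` is 0, nonnegativity forces x to
    -- vanish. Where `r` is 1, a x + y takes the same value as at the first coordinate, which bounds
    -- both x and y from above, so x equals its first coordinate there. Thus x is its first
    -- coordinate times `r`.
    · intro x y a hx hy ha hxy
      obtain ⟨c, hc⟩ := Submodule.mem_span_singleton.1 hxy
      have hc' : ∀ i, (c : ℝ) * r i = a * x i + y i := fun i => congrFun hc i
      refine Submodule.mem_span_singleton.2
        ⟨⟨x (Sum.inl ⟨0, hk⟩), (le_first_of_mem_cone hx hk _).1⟩, funext fun s => ?_⟩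
      change x (Sum.inl ⟨0, hk⟩) * (r s : ℝ) = x s
      obtain ⟨hx0, hx1⟩ := le_first_of_mem_cone hx hk s
      obtain ⟨hy0, hy1⟩ := le_first_of_mem_cone hy hk s
      have e0 := hc' (Sum.inl ⟨0, hk⟩)
      have es := hc' s
      rw [hfirst] at e0
      rcases Nat.le_one_iff_eq_zero_or_eq_one.1 (h1 s) with h | h
      · rw [h] at es ⊢
        have : a * x s = 0 := by
          have := mul_nonneg ha.le hx0
          push_cast at es
          linarith
        rcases mul_eq_zero.1 this with h' | h'
        · exact absurd h' ha.ne'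
        · simp [h']
      · rw [h] at es ⊢
        have : a * (x (Sum.inl ⟨0, hk⟩) - x s) = 0 := by
          have := mul_nonneg ha.le (sub_nonneg.2 hx1)
          push_cast at es e0
          nlinarith
        rcases mul_eq_zero.1 this with h' | h'
        · exact absurd h' ha.ne'
        · push_cast
          linarith

theorem first_eq_one_of_mem_S {k : ℕ} {r : Fin k ⊕ Fin k →₀ ℕ} (hr : r ∈ S k) (hk : 0 < k) :
    r (Sum.inl ⟨0, hk⟩) = 1 := by
  obtain ⟨hp, h1, h0⟩ := mem_S_iff.1 hr
  exact le_antisymm (h1 _) (hp.first_pos h0)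

/-! ### Decomposition by support -/

open Classical in
/-- The sum of `x^λ y^μ` over the pairs `∅ ≤ μ ≤ λ` whose support satisfies `p`. -/
def supportSeries (R : Type*) [CommRing R] (k : ℕ) (p : Finset (Fin k ⊕ Fin k) → Prop) :
    MvPowerSeries (Fin k ⊕ Fin k) R :=
  fun e => if IsPartitionPair e ∧ p e.support then 1 else 0

open Classical in
theorem coeff_supportSeries {R : Type*} [CommRing R] {k : ℕ} (p : Finset (Fin k ⊕ Fin k) → Prop)
    (e : Fin k ⊕ Fin k →₀ ℕ) : MvPowerSeries.coeff e (supportSeries R k p) =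
      if IsPartitionPair e ∧ p e.support then 1 else 0 := rfl

theorem Qtilde_eq_supportSeries (R : Type*) [CommRing R] (k : ℕ) :
    Qtilde R k = supportSeries R k fun _ => True := by
  funext e
  simp only [Qtilde, supportSeries]
  by_cases he : IsPartitionPair e
  · rw [if_pos he, if_pos ⟨he, trivial⟩]
  · rw [if_neg he, if_neg fun h => he h.1]

theorem Q_eq_supportSeries (R : Type*) [CommRing R] (k : ℕ) :
    Q R k = supportSeries R k fun s => ∀ i : Fin k, Sum.inl i ∈ s := by
  funext e
  have h : (∀ i : Fin k, 0 < e (Sum.inl i)) ↔ ∀ i : Fin k, Sum.inl i ∈ e.support := by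
    simp only [Finsupp.mem_support_iff, Nat.pos_iff_ne_zero]
  simp only [Q, supportSeries]
  by_cases he : IsPartitionPair e ∧ ∀ i : Fin k, 0 < e (Sum.inl i)
  · rw [if_pos he, if_pos ⟨he.1, h.1 he.2⟩]
  · rw [if_neg he, if_neg fun h' => he ⟨h'.1, h.2 h'.2⟩]

/-- The indicator of the support of `e`, as an exponent. -/
def supportIndicator {σ : Type*} (e : σ →₀ ℕ) : σ →₀ ℕ := e.mapRange (min · 1) rfl

theorem supportIndicator_apply {σ : Type*} (e : σ →₀ ℕ) (i : σ) :
    supportIndicator e i = min (e i) 1 := rfl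

theorem support_supportIndicator {σ : Type*} (e : σ →₀ ℕ) :
    (supportIndicator e).support = e.support := by
  ext i
  simp only [Finsupp.mem_support_iff, supportIndicator_apply]
  omega

theorem supportIndicator_mem_S {k : ℕ} {e : Fin k ⊕ Fin k →₀ ℕ} (he : IsPartitionPair e)
    (h0 : e ≠ 0) : supportIndicator e ∈ S k := by
  refine mem_S_iff.2 ⟨⟨fun i j h => ?_, fun i j h => ?_, fun i => ?_⟩, fun i => ?_, fun h => h0 ?_⟩
  · exact min_le_min_right 1 (he.1 h)
  · exact min_le_min_right 1 (he.2.1 h)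
  · exact min_le_min_right 1 (he.2.2 i)
  · exact min_le_right _ _
  · rw [← Finsupp.support_eq_empty, ← support_supportIndicator, h, Finsupp.support_zero]

theorem eq_supportIndicator_of_mem_S {k : ℕ} {r e : Fin k ⊕ Fin k →₀ ℕ} (hr : r ∈ S k)
    (h : e.support = r.support) : r = supportIndicator e := by
  ext i
  have h1 := (mem_S_iff.1 hr).2.1 i
  have h2 : e i ≠ 0 ↔ r i ≠ 0 := by
    rw [← Finsupp.mem_support_iff, ← Finsupp.mem_support_iff, h]
  rw [supportIndicator_apply]
  omega

/-- Since `r` is 1 exactly on the support of `e`, subtracting it lowers every nonzero entry by one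
and keeps every zero, which preserves all the inequalities between entries. -/
theorem isPartitionPair_sub_iff {k : ℕ} {r e : Fin k ⊕ Fin k →₀ ℕ} (hr : r ∈ S k) :
    r ≤ e ∧ IsPartitionPair (e - r) ∧ (e - r).support ⊆ r.support ↔
      IsPartitionPair e ∧ e.support = r.support := by
  obtain ⟨hp, h1, -⟩ := mem_S_iff.1 hr
  constructor
  · rintro ⟨hle, hd, hs⟩
    obtain ⟨d, rfl⟩ := exists_add_of_le hle
    rw [add_tsub_cancel_left] at hd hs
    refine ⟨hp.add hd, ?_⟩
    rw [Finsupp.support_add_eq_union]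
    exact Finset.union_eq_left.2 hs
  · rintro ⟨he, hs⟩
    have h2 : ∀ i, e i ≠ 0 ↔ r i ≠ 0 := fun i => by
      rw [← Finsupp.mem_support_iff, ← Finsupp.mem_support_iff, hs]
    refine ⟨fun i => ?_, ⟨fun i j h => ?_, fun i j h => ?_, fun i => ?_⟩, fun i => ?_⟩
    · have := h2 i
      have := h1 i
      omega
    · have := he.1 h
      have := h2 (Sum.inl i)
      have := h2 (Sum.inl j)
      have := h1 (Sum.inl i)
      have := h1 (Sum.inl j)
      simp only [Finsupp.tsub_apply] at *
      omega
    · have := he.2.1 h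
      have := h2 (Sum.inr i)
      have := h2 (Sum.inr j)
      have := h1 (Sum.inr i)
      have := h1 (Sum.inr j)
      simp only [Finsupp.tsub_apply] at *
      omega
    · have := he.2.2 i
      have := h2 (Sum.inr i)
      have := h2 (Sum.inl i)
      have := h1 (Sum.inr i)
      have := h1 (Sum.inl i)
      simp only [Finsupp.tsub_apply] at *
      omega
    · have := h2 i
      simp only [Finsupp.mem_support_iff, Finsupp.tsub_apply]
      omega

open Classical in
theorem coeff_monomial_mul_supportSeries {R : Type*} [CommRing R] {k : ℕ}
    {r : Fin k ⊕ Fin k →₀ ℕ} (hr : r ∈ S k) (e : Fin k ⊕ Fin k →₀ ℕ) :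
    MvPowerSeries.coeff e (MvPowerSeries.monomial r 1 * supportSeries R k (· ⊆ r.support)) =
      if IsPartitionPair e ∧ e.support = r.support then 1 else 0 := by
  have h := isPartitionPair_sub_iff hr (e := e)
  rw [MvPowerSeries.coeff_monomial_mul, coeff_supportSeries, one_mul]
  by_cases h2 : IsPartitionPair e ∧ e.support = r.support
  · rw [if_pos h2, if_pos (h.2 h2).1, if_pos (h.2 h2).2]
  · rw [if_neg h2]
    by_cases h1 : r ≤ e
    · rw [if_pos h1, if_neg fun h3 => h2 (h.1 ⟨h1, h3⟩)]
    · rw [if_neg h1]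

open Classical in
/-- Sorting the pairs by their support: those with the same support as `r ∈ S k` are the sums
of `r` and a pair supported in the support of `r`. -/
theorem supportSeries_eq_sum (R : Type*) [CommRing R] (k : ℕ)
    (p : Finset (Fin k ⊕ Fin k) → Prop) :
    supportSeries R k p = MvPowerSeries.C (if p ∅ then 1 else 0) +
      ∑ r ∈ (S_finite k).toFinset with p r.support,
        MvPowerSeries.monomial r 1 * supportSeries R k (· ⊆ r.support) := by
  ext e
  rw [map_add, map_sum, Finset.sum_congr rfl fun r hr => coeff_monomial_mul_supportSeries
    ((S_finite k).mem_toFinset.1 (Finset.mem_filter.1 hr).1) e, coeff_supportSeries, MvPowerSeries.coeff_C]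
  have hS : ∀ r ∈ S k, r.support ≠ ∅ := fun r hr h =>
    (mem_S_iff.1 hr).2.2 (Finsupp.support_eq_empty.1 h)
  by_cases he : IsPartitionPair e
  · by_cases h0 : e = 0
    · subst h0
      rw [Finset.sum_eq_zero]
      · simp [IsPartitionPair.zero]
      · intro r hr
        have := hS r (by simpa using (Finset.mem_filter.1 hr).1)
        simp [this.symm]
    -- Only the indicator of `e` shares its support, so the sum over `r` has at most one nonzero
    -- term.
    · have hsum : ∀ r ∈ (S_finite k).toFinset.filter (fun r => p r.support),
          (if IsPartitionPair e ∧ e.support = r.support then (1 : R) else 0) =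
            if r = supportIndicator e then 1 else 0 := by
        intro r hr
        refine if_congr ⟨fun h => ?_, ?_⟩ rfl rfl
        · exact eq_supportIndicator_of_mem_S (by simpa using (Finset.mem_filter.1 hr).1) h.2
        · rintro rfl
          exact ⟨he, (support_supportIndicator e).symm⟩
      rw [Finset.sum_congr rfl hsum, Finset.sum_ite_eq']
      simp [h0, he, supportIndicator_mem_S he h0, support_supportIndicator]
  · have h0 : e ≠ 0 := by
      rintro rfl
      exact he IsPartitionPair.zero
    simp [he, h0]

/-- The factor of `D` at the ray point `r`. -/
abbrev rayFactor (R : Type*) [CommRing R] {σ : Type*} (r : σ →₀ ℕ) : MvPolynomial σ R :=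
  1 - MvPolynomial.monomial r 1

/-- `F * p` is a polynomial. -/
def IsDenominator {σ R : Type*} [CommRing R] (F : MvPowerSeries σ R) (p : MvPolynomial σ R) :
    Prop :=
  ∃ N : MvPolynomial σ R, F * (p : MvPowerSeries σ R) = (N : MvPowerSeries σ R)

theorem IsDenominator.of_dvd {σ R : Type*} [CommRing R] {F : MvPowerSeries σ R}
    {p q : MvPolynomial σ R} (h : IsDenominator F p) (hpq : p ∣ q) : IsDenominator F q := by
  obtain ⟨N, hN⟩ := h
  obtain ⟨c, rfl⟩ := hpq
  exact ⟨N * c, by rw [MvPolynomial.coe_mul, ← mul_assoc, hN, MvPolynomial.coe_mul]⟩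

theorem IsDenominator.coe_mul {σ R : Type*} [CommRing R] {F : MvPowerSeries σ R}
    {p : MvPolynomial σ R} (h : IsDenominator F p) (q : MvPolynomial σ R) :
    IsDenominator ((q : MvPowerSeries σ R) * F) p := by
  obtain ⟨N, hN⟩ := h
  exact ⟨q * N, by rw [mul_assoc, hN, MvPolynomial.coe_mul]⟩

theorem IsDenominator.coe {σ R : Type*} [CommRing R] (q p : MvPolynomial σ R) :
    IsDenominator (q : MvPowerSeries σ R) p :=
  ⟨q * p, (MvPolynomial.coe_mul _ _).symm⟩

theorem IsDenominator.add {σ R : Type*} [CommRing R] {F G : MvPowerSeries σ R}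
    {p : MvPolynomial σ R} (hF : IsDenominator F p) (hG : IsDenominator G p) :
    IsDenominator (F + G) p := by
  obtain ⟨N, hN⟩ := hF
  obtain ⟨M, hM⟩ := hG
  exact ⟨N + M, by rw [add_mul, hN, hM, MvPolynomial.coe_add]⟩

theorem IsDenominator.sum {σ R ι : Type*} [CommRing R] {F : ι → MvPowerSeries σ R}
    {p : MvPolynomial σ R} (s : Finset ι) (h : ∀ i ∈ s, IsDenominator (F i) p) :
    IsDenominator (∑ i ∈ s, F i) p := by
  classical
  induction s using Finset.induction_on with
  | empty => exact ⟨0, by simp⟩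
  | insert a s ha ih =>
    rw [Finset.sum_insert ha]
    exact (h a (by simp)).add (ih fun i hi => h i (by simp [hi]))

open Classical in
-- Sorting by support writes the series as a constant plus monomial multiples of the series attached
-- to single ray points, so a common denominator of the latter suffices.
theorem IsDenominator.supportSeries_of_forall {R : Type*} [CommRing R] {k : ℕ}
    {p : Finset (Fin k ⊕ Fin k) → Prop} {q : MvPolynomial (Fin k ⊕ Fin k) R}
    (h : ∀ r ∈ S k, p r.support → IsDenominator (supportSeries R k (· ⊆ r.support)) q) :
    IsDenominator (supportSeries R k p) q := by
  rw [supportSeries_eq_sum, ← MvPolynomial.coe_C]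
  refine (IsDenominator.coe _ _).add (IsDenominator.sum _ fun r hr => ?_)
  rw [← MvPolynomial.coe_monomial]
  obtain ⟨h1, h2⟩ := Finset.mem_filter.1 hr
  exact (h r (by simpa using h1) h2).coe_mul _

/-- Shifting by `r` maps the pairs supported in `r` bijectively onto those with support exactly that
of `r`; subtracting these leaves the strictly smaller supports. -/
theorem supportSeries_mul_rayFactor (R : Type*) [CommRing R] {k : ℕ}
    {r : Fin k ⊕ Fin k →₀ ℕ} (hr : r ∈ S k) :
    supportSeries R k (· ⊆ r.support) * (rayFactor R r : MvPowerSeries _ R) =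
      supportSeries R k (· ⊂ r.support) := by
  classical
  ext e
  have : supportSeries R k (· ⊆ r.support) * (rayFactor R r : MvPowerSeries _ R) =
      supportSeries R k (· ⊆ r.support) -
        MvPowerSeries.monomial r 1 * supportSeries R k (· ⊆ r.support) := by
    rw [rayFactor, sub_eq_add_neg, MvPolynomial.coe_add, ← map_neg, MvPolynomial.coe_monomial,
      map_neg, MvPolynomial.coe_one]
    ring
  rw [this, map_sub, coeff_monomial_mul_supportSeries hr, coeff_supportSeries,
    coeff_supportSeries]
  by_cases h1 : e.support = r.support
  · simp [h1]
  · simp [h1, Finset.ssubset_iff_subset_ne]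

theorem le_of_support_subset {k : ℕ} {s r : Fin k ⊕ Fin k →₀ ℕ} (hs : s ∈ S k)
    (h : s.support ⊆ r.support) : s ≤ r := by
  intro i
  have h1 := (mem_S_iff.1 hs).2.1 i
  have h2 : s i ≠ 0 → r i ≠ 0 := fun hi =>
    Finsupp.mem_support_iff.1 (h (Finsupp.mem_support_iff.2 hi))
  omega

/-- Strong induction on the size of the support. The series of strictly smaller supports already has
the product over `s < r` as denominator, and the factor at `r` reduces to that series. -/
theorem isDenominator_supportSeries_subset (R : Type*) [CommRing R] {k : ℕ} (n : ℕ) :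
    ∀ r ∈ S k, r.support.card = n → IsDenominator (supportSeries R k (· ⊆ r.support))
      (∏ s ∈ (S_finite k).toFinset with s ≤ r, rayFactor R s) := by
  classical
  induction n using Nat.strong_induction_on with
  | _ n ih =>
    intro r hr hn
    have hlt : IsDenominator (supportSeries R k (· ⊂ r.support))
        (∏ s ∈ (S_finite k).toFinset with s < r, rayFactor R s) := by
      refine IsDenominator.supportSeries_of_forall fun s hs hsr => ?_
      refine (ih _ (hn ▸ Finset.card_lt_card hsr) s hs rfl).of_dvd
        (Finset.prod_dvd_prod_of_subset _ _ _ fun t ht => ?_)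
      obtain ⟨h1, h2⟩ := Finset.mem_filter.1 ht
      refine Finset.mem_filter.2 ⟨h1, h2.trans_lt ?_⟩
      refine lt_of_le_of_ne (le_of_support_subset hs hsr.1) ?_
      rintro rfl
      exact hsr.2 subset_rfl
    have hsplit : (S_finite k).toFinset.filter (· ≤ r) =
        insert r ((S_finite k).toFinset.filter (· < r)) := by
      ext t
      simp only [Finset.mem_filter, Finset.mem_insert, Set.Finite.mem_toFinset, le_iff_lt_or_eq]
      constructor
      · rintro ⟨h1, h2 | h2⟩
        · exact Or.inr ⟨h1, h2⟩
        · exact Or.inl h2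
      · rintro (rfl | ⟨h1, h2⟩)
        · exact ⟨hr, Or.inr rfl⟩
        · exact ⟨h1, Or.inl h2⟩
    obtain ⟨N, hN⟩ := hlt
    refine ⟨N, ?_⟩
    rw [hsplit, Finset.prod_insert (by simp), MvPolynomial.coe_mul, ← mul_assoc,
      supportSeries_mul_rayFactor R hr, hN]

theorem isDenominator_supportSeries (R : Type*) [CommRing R] (k : ℕ)
    (p : Finset (Fin k ⊕ Fin k) → Prop) : IsDenominator (supportSeries R k p) (D R k) := by
  classical
  refine IsDenominator.supportSeries_of_forall fun r hr _ => ?_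
  exact (isDenominator_supportSeries_subset R _ r hr rfl).of_dvd
    (Finset.prod_dvd_prod_of_subset _ _ _ (Finset.filter_subset _ _))

/-! ### Lowest terms -/

/-- The polynomial is linear in x_1, because the first entry of `r` is 1; its leading coefficient is
a nonzero monomial free of x_1 and its constant term is 1, so the two are coprime. -/
theorem irreducible_rayFactor (R : Type*) [CommRing R] [IsDomain R] {k : ℕ}
    {r : Fin k ⊕ Fin k →₀ ℕ} (hr : r ∈ S k) : Irreducible (rayFactor R r) := by
  classical
  have hk : 0 < k := pos_of_ne_zero (mem_S_iff.1 hr).2.2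
  have h1 := first_eq_one_of_mem_S hr hk
  have hmon : rayFactor R r = MvPolynomial.monomial (r.erase (Sum.inl ⟨0, hk⟩)) (-1) *
      MvPolynomial.X (Sum.inl ⟨0, hk⟩) + 1 := by
    conv_lhs => rw [rayFactor, ← Finsupp.erase_add_single (Sum.inl ⟨0, hk⟩) r, h1]
    rw [MvPolynomial.X, MvPolynomial.monomial_mul]
    simp only [mul_one, map_neg]
    ring
  rw [hmon]
  refine MvPolynomial.irreducible_mul_X_add _ _ _ (by simp) ?_ (by simp) isRelPrime_one_right
  rw [MvPolynomial.vars_monomial (by simp)]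
  simp

/-- Multiplication by factors `1 - m_t` with `t ≠ r` does not change the coefficients along the
ray `e₀ + ℕ r` if no point of the ray is the sum of an exponent of the series and such a `t`. -/
theorem coeff_mul_prod_rayFactor {σ R : Type*} [CommRing R] {A : Set (σ →₀ ℕ)}
    {T : Finset (σ →₀ ℕ)} {F : MvPowerSeries σ R} (ray : ℕ → σ →₀ ℕ)
    (hA : ∀ a ∈ A, ∀ t ∈ T, t + a ∈ A) (hray : ∀ n, ∀ a ∈ A, ∀ t ∈ T, ray n ≠ t + a)
    (hF : ∀ e, e ∉ A → F.coeff e = 0) (n : ℕ) :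
    (F * ((∏ t ∈ T, rayFactor R t : MvPolynomial σ R) : MvPowerSeries σ R)).coeff (ray n) =
      F.coeff (ray n) := by
  classical
  -- The induction must also carry that each partial product has its exponents in `A`, which is what
  -- makes `hray` applicable to the next factor.
  suffices h : (∀ e, e ∉ A → (F * ((∏ t ∈ T, rayFactor R t : MvPolynomial σ R) :
      MvPowerSeries σ R)).coeff e = 0) ∧ (F * ((∏ t ∈ T, rayFactor R t : MvPolynomial σ R) :
      MvPowerSeries σ R)).coeff (ray n) = F.coeff (ray n) from h.2
  induction T using Finset.induction_on with
  | empty => simpa using hF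
  | insert t T ht ih =>
    obtain ⟨ih1, ih2⟩ := ih (fun a ha s hs => hA a ha s (by simp [hs]))
      (fun n a ha s hs => hray n a ha s (by simp [hs]))
    set G := F * ((∏ t ∈ T, rayFactor R t : MvPolynomial σ R) : MvPowerSeries σ R) with hG
    have hmul : F * ((∏ t ∈ insert t T, rayFactor R t : MvPolynomial σ R) : MvPowerSeries σ R) =
        G - MvPowerSeries.monomial t 1 * G := by
      have hcoe : ((rayFactor R t : MvPolynomial σ R) : MvPowerSeries σ R) =
          1 - MvPowerSeries.monomial t 1 := by
        rw [rayFactor, sub_eq_add_neg, MvPolynomial.coe_add, ← map_neg, MvPolynomial.coe_monomial,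
          map_neg, MvPolynomial.coe_one, sub_eq_add_neg]
      rw [Finset.prod_insert ht, MvPolynomial.coe_mul, hcoe, hG]
      ring
    have hzero : ∀ e, (∀ a ∈ A, e ≠ t + a) →
        (MvPowerSeries.monomial t 1 * G).coeff e = 0 := by
      intro e he
      rw [MvPowerSeries.coeff_monomial_mul]
      split_ifs with hle
      · rw [one_mul]
        exact ih1 _ fun h => he _ h (add_tsub_cancel_of_le hle).symm
      · rfl
    rw [hmul]
    refine ⟨fun e he => ?_, ?_⟩
    · rw [map_sub, ih1 e he, hzero e, sub_zero]
      rintro a ha rfl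
      exact he (hA a ha t (by simp))
    · rw [map_sub, ih2, hzero _ fun a ha => hray n a ha t (by simp), sub_zero]

/-- Upward closure of `p` keeps the exponent set stable under adding points of `S k`, as
`coeff_mul_prod_rayFactor` requires, and keeps the whole ray from `e₀` inside it. -/
theorem isReducedDenominator_of_rays {R : Type*} [CommRing R] [IsDomain R]
    [UniqueFactorizationMonoid R] {k : ℕ} {p : Finset (Fin k ⊕ Fin k) → Prop}
    (hp : ∀ s t, s ⊆ t → p s → p t)
    (hray : ∀ r ∈ S k, ∃ e₀, IsPartitionPair e₀ ∧ p e₀.support ∧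
      ∀ n : ℕ, ∀ a, IsPartitionPair a → p a.support → ∀ t ∈ S k, e₀ + n • r = t + a → t = r) :
    IsReducedDenominator (supportSeries R k p) (D R k) := by
  classical
  obtain ⟨N, hN⟩ := isDenominator_supportSeries R k p
  refine ⟨N, hN, IsRelPrime.prod_right fun r hr => ?_⟩
  have hrS : r ∈ S k := by simpa using hr
  refine IsRelPrime.symm ((irreducible_rayFactor R hrS).isRelPrime_iff_not_dvd.2 ?_)
  rintro ⟨M, rfl⟩
  have hD : D R k = rayFactor R r * ∏ t ∈ (S_finite k).toFinset.erase r, rayFactor R t :=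
    (Finset.mul_prod_erase _ _ hr).symm
  have hne : ((rayFactor R r : MvPolynomial _ R) : MvPowerSeries (Fin k ⊕ Fin k) R) ≠ 0 := by
    rw [← MvPolynomial.coe_zero, Ne, MvPolynomial.coe_inj]
    exact (irreducible_rayFactor R hrS).ne_zero
  -- Cancelling the factor at `r` in the domain of power series exhibits the series times the other
  -- factors as the polynomial `M`.
  have hM : supportSeries R k p * ((∏ t ∈ (S_finite k).toFinset.erase r, rayFactor R t :
      MvPolynomial (Fin k ⊕ Fin k) R) : MvPowerSeries (Fin k ⊕ Fin k) R) = M := by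
    refine mul_left_cancel₀ hne ?_
    rw [← MvPolynomial.coe_mul, ← hN, hD, MvPolynomial.coe_mul]
    ring
  obtain ⟨e₀, he₀, hpe₀, huniq⟩ := hray r hrS
  have hrp := (mem_S_iff.1 hrS).1
  have hcoeff : ∀ n : ℕ, M.coeff (e₀ + n • r) = 1 := by
    intro n
    rw [← MvPolynomial.coeff_coe, ← hM, coeff_mul_prod_rayFactor
      (A := {e | IsPartitionPair e ∧ p e.support}) fun n => e₀ + n • r]
    · rw [coeff_supportSeries, if_pos]
      refine ⟨he₀.add (hrp.nsmul n), hp _ _ ?_ hpe₀⟩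
      rw [Finsupp.support_add_eq_union]
      exact Finset.subset_union_left
    · rintro a ⟨ha1, ha2⟩ t ht
      have htS : t ∈ S k := by simpa using Finset.mem_of_mem_erase ht
      refine ⟨(mem_S_iff.1 htS).1.add ha1, hp _ _ ?_ ha2⟩
      rw [Finsupp.support_add_eq_union]
      exact Finset.subset_union_right
    · rintro n a ⟨ha1, ha2⟩ t ht heq
      exact Finset.ne_of_mem_erase ht
        (huniq n a ha1 ha2 t (by simpa using Finset.mem_of_mem_erase ht) heq)
    · intro e he
      exact if_neg he
  have hinj : Function.Injective fun n : ℕ => e₀ + n • r := by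
    intro m n hmn
    have hk : 0 < k := pos_of_ne_zero (mem_S_iff.1 hrS).2.2
    have := DFunLike.congr_fun hmn (Sum.inl ⟨0, hk⟩)
    simpa [first_eq_one_of_mem_S hrS hk] using this
  refine Set.infinite_range_of_injective hinj (M.support.finite_toSet.subset ?_)
  rintro _ ⟨n, rfl⟩
  simp [hcoeff n]

theorem isReducedDenominator_Qtilde (R : Type*) [CommRing R] [IsDomain R]
    [UniqueFactorizationMonoid R] (k : ℕ) : IsReducedDenominator (Qtilde R k) (D R k) := by
  rw [Qtilde_eq_supportSeries]
  -- The ray starts at 0. If `n • r = t + a`, the first entry of `a` is n - 1 and bounds all its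
  -- entries, so `t` is 1 wherever `r` is; where `r` is 0, so is `t`.
  refine isReducedDenominator_of_rays (fun _ _ _ _ => trivial) fun r hr =>
    ⟨0, IsPartitionPair.zero, trivial, fun n a ha _ t ht h => ?_⟩
  have hk : 0 < k := pos_of_ne_zero (mem_S_iff.1 hr).2.2
  have h' : ∀ s, n * r s = t s + a s := fun s => by simpa using DFunLike.congr_fun h s
  ext s
  have e0 := h' (Sum.inl ⟨0, hk⟩)
  have es := h' s
  have := ha.le_first hk s
  rw [first_eq_one_of_mem_S hr, first_eq_one_of_mem_S ht] at e0
  have ht1 := (mem_S_iff.1 ht).2.1 s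
  rcases Nat.le_one_iff_eq_zero_or_eq_one.1 ((mem_S_iff.1 hr).2.1 s) with h1 | h1 <;>
    rw [h1] at es ⊢ <;> omega

theorem isReducedDenominator_Q (R : Type*) [CommRing R] [IsDomain R]
    [UniqueFactorizationMonoid R] (k : ℕ) : IsReducedDenominator (Q R k) (D R k) := by
  rw [Q_eq_supportSeries]
  refine isReducedDenominator_of_rays (fun s t hst h i => hst (h i)) fun r hr => ?_
  obtain ⟨hrp, hr1, hr0⟩ := mem_S_iff.1 hr
  have hk : 0 < k := pos_of_ne_zero hr0
  -- The start is λ = (1^k) with μ that of `r`. The first entry of `a` is then n, which forces `t`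
  -- to be 1 where `r` is. Where the λ-part of `r` is 0, the sum is 1 and positivity of `a` forces
  -- `t` to be 0; this is why all λ-entries start at 1.
  refine ⟨Finsupp.equivFunOnFinite.symm (Sum.elim (fun _ => 1) fun i => r (Sum.inr i)),
    ⟨fun _ _ _ => le_rfl, hrp.2.1, fun i => hr1 _⟩, fun i => by simp, fun n a ha hpa t ht h => ?_⟩
  have hl : ∀ i, 1 + n * r (Sum.inl i) = t (Sum.inl i) + a (Sum.inl i) := fun i => by
    simpa using DFunLike.congr_fun h (Sum.inl i)
  have hm : ∀ i, r (Sum.inr i) + n * r (Sum.inr i) = t (Sum.inr i) + a (Sum.inr i) := fun i => by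
    simpa using DFunLike.congr_fun h (Sum.inr i)
  have e0 := hl ⟨0, hk⟩
  rw [first_eq_one_of_mem_S hr, first_eq_one_of_mem_S ht] at e0
  ext s
  have hle := ha.le_first hk s
  have ht1 := (mem_S_iff.1 ht).2.1 s
  rcases s with i | i
  · have es := hl i
    have hpos := Finsupp.mem_support_iff.1 (hpa i)
    rcases Nat.le_one_iff_eq_zero_or_eq_one.1 (hr1 (Sum.inl i)) with h1 | h1 <;>
      rw [h1] at es ⊢ <;> omega
  · have es := hm i
    rcases Nat.le_one_iff_eq_zero_or_eq_one.1 (hr1 (Sum.inr i)) with h1 | h1 <;>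
      rw [h1] at es ⊢ <;> omega

/-! ### The specialization `y_1 = ⋯ = y_k = y` -/

theorem mapDomain_collapse_inl {k : ℕ} (e : Fin k ⊕ Fin k →₀ ℕ) (i : Fin k) :
    e.mapDomain (collapse k) (Sum.inl i) = e (Sum.inl i) := by
  classical
  simp [Finsupp.mapDomain, Finsupp.sum_fintype, Finsupp.single_apply, collapse]

theorem mapDomain_collapse_inr {k : ℕ} (e : Fin k ⊕ Fin k →₀ ℕ) :
    e.mapDomain (collapse k) (Sum.inr ()) = ∑ i, e (Sum.inr i) := by
  simp [Finsupp.mapDomain, Finsupp.sum_fintype, collapse]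

theorem mapDomain_collapse_eq_iff {k : ℕ} (e : Fin k ⊕ Fin k →₀ ℕ) (f : Fin k ⊕ Unit →₀ ℕ) :
    e.mapDomain (collapse k) = f ↔
      (∀ i, e (Sum.inl i) = f (Sum.inl i)) ∧ ∑ i, e (Sum.inr i) = f (Sum.inr ()) := by
  rw [DFunLike.ext_iff, Sum.forall]
  simp only [mapDomain_collapse_inl, Unique.forall_iff, PUnit.default_eq_unit,
    mapDomain_collapse_inr]

open Classical in
theorem rename_collapse_Q (R : Type*) [CommRing R] (k : ℕ) :
    MvPowerSeries.rename (collapse k) (Q R k) = Qsingle R k := by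
  ext f
  rw [MvPowerSeries.coeff_rename]
  change ∑ e ∈ _, (if IsPartitionPair e ∧ ∀ i : Fin k, 0 < e (Sum.inl i) then (1 : R) else 0) =
    if Antitone (fun i : Fin k => f (Sum.inl i)) ∧ ∀ i : Fin k, 0 < f (Sum.inl i) then
      (P R (fun i : Fin k => f (Sum.inl i))).coeff (f (Sum.inr ())) else 0
  split_ifs with hf
  · rw [P, Polynomial.finsetSum_coeff]
    simp_rw [Polynomial.coeff_X_pow]
    rw [← Finset.sum_filter, ← Finset.sum_filter]
    -- The exponent `f` prescribes λ and |μ|, so a pair in its fibre is determined by μ.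
    refine Finset.sum_nbij' (fun e i => e (Sum.inr i))
      (fun μ => Finsupp.equivFunOnFinite.symm (Sum.elim (fun i => f (Sum.inl i)) μ)) ?_ ?_ ?_ ?_ ?_
    · intro e he
      simp only [Finset.mem_filter, Set.Finite.mem_toFinset, Set.mem_preimage,
        Set.mem_singleton_iff, mapDomain_collapse_eq_iff] at he
      obtain ⟨⟨h1, h2⟩, h3, -⟩ := he
      simp only [Finset.mem_filter, Finset.mem_Iic]
      exact ⟨⟨fun i => (h3.2.2 i).trans (h1 i).le, h3.2.1⟩, h2.symm⟩
    · intro μ hμ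
      simp only [Finset.mem_filter, Finset.mem_Iic] at hμ
      obtain ⟨⟨h1, h2⟩, h3⟩ := hμ
      simp only [Finset.mem_filter, Set.Finite.mem_toFinset, Set.mem_preimage,
        Set.mem_singleton_iff, mapDomain_collapse_eq_iff]
      exact ⟨⟨fun i => rfl, h3.symm⟩, ⟨hf.1, h2, h1⟩, hf.2⟩
    · intro e he
      simp only [Finset.mem_filter, Set.Finite.mem_toFinset, Set.mem_preimage,
        Set.mem_singleton_iff, mapDomain_collapse_eq_iff] at he
      ext s
      rcases s with i | i
      · exact (he.1.1 i).symm
      · rfl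
    · intro μ _
      rfl
    · intro _ _
      rfl
  · refine Finset.sum_eq_zero fun e he => if_neg fun h => hf ?_
    simp only [Set.Finite.mem_toFinset, Set.mem_preimage, Set.mem_singleton_iff,
      mapDomain_collapse_eq_iff] at he
    simp_rw [← he.1]
    exact ⟨h.1.1, h.2⟩

/-- The ray point `(1^m, 1^j)`. -/
def rayPoint (k m j : ℕ) : Fin k ⊕ Fin k →₀ ℕ :=
  Finsupp.equivFunOnFinite.symm
    (Sum.elim (fun i => if (i : ℕ) < m then 1 else 0) fun i => if (i : ℕ) < j then 1 else 0)

theorem rayPoint_inl (k m j : ℕ) (i : Fin k) :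
    rayPoint k m j (Sum.inl i) = if (i : ℕ) < m then 1 else 0 := rfl

theorem rayPoint_inr (k m j : ℕ) (i : Fin k) :
    rayPoint k m j (Sum.inr i) = if (i : ℕ) < j then 1 else 0 := rfl

theorem sum_ite_val_lt {k m : ℕ} (hm : m ≤ k) :
    ∑ i : Fin k, (if (i : ℕ) < m then 1 else 0) = m := by
  rw [Fin.sum_univ_eq_sum_range (fun i => if i < m then 1 else 0) k, ← Finset.sum_filter,
    Finset.sum_const, smul_eq_mul, mul_one]
  have : (Finset.range k).filter (· < m) = Finset.range m := by
    ext i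
    simp only [Finset.mem_filter, Finset.mem_range]
    omega
  rw [this, Finset.card_range]

theorem rayPoint_mem_S {k m j : ℕ} (hm : 1 ≤ m) (hmk : m ≤ k) (hj : j ≤ m) :
    rayPoint k m j ∈ S k := by
  refine mem_S_iff.2 ⟨⟨fun a b h => ?_, fun a b h => ?_, fun i => ?_⟩, ?_, fun h => ?_⟩
  · have h : (a : ℕ) ≤ b := h
    simp only [rayPoint_inl]
    split_ifs <;> omega
  · have h : (a : ℕ) ≤ b := h
    simp only [rayPoint_inr]
    split_ifs <;> omega
  · simp only [rayPoint_inr, rayPoint_inl]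
    split_ifs <;> omega
  · rintro (i | i)
    · rw [rayPoint_inl]
      split_ifs <;> simp
    · rw [rayPoint_inr]
      split_ifs <;> simp
  · have := DFunLike.congr_fun h (Sum.inl ⟨0, by omega⟩)
    rw [rayPoint_inl, if_pos (Nat.lt_of_succ_le hm)] at this
    simp at this

/-- The cutoff is the least `m` from which `f` vanishes; by minimality, any earlier index has a
nonzero entry at or after it, so antitonicity makes its own entry 1. -/
theorem exists_eq_ite_of_antitone {k : ℕ} {f : Fin k → ℕ} (hf : Antitone f) (h1 : ∀ i, f i ≤ 1) :
    ∃ m ≤ k, ∀ i : Fin k, f i = if (i : ℕ) < m then 1 else 0 := by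
  classical
  have hex : ∃ m, ∀ i : Fin k, m ≤ (i : ℕ) → f i = 0 := ⟨k, fun i h => absurd i.2 h.not_gt⟩
  refine ⟨Nat.find hex, Nat.find_min' hex fun i h => absurd i.2 h.not_gt, fun i => ?_⟩
  split_ifs with h
  · have := Nat.find_min hex h
    push Not at this
    obtain ⟨l, hl, hl0⟩ := this
    have h2 : f l ≤ f i := hf hl
    have := h1 i
    omega
  · exact Nat.find_spec hex i (not_lt.1 h)

theorem exists_rayPoint_of_mem_S {k : ℕ} {r : Fin k ⊕ Fin k →₀ ℕ} (hr : r ∈ S k) :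
    ∃ m j, 1 ≤ m ∧ m ≤ k ∧ j ≤ m ∧ rayPoint k m j = r := by
  obtain ⟨hp, h1, h0⟩ := mem_S_iff.1 hr
  obtain ⟨m, hm, hml⟩ := exists_eq_ite_of_antitone hp.1 fun i => h1 _
  obtain ⟨j, hj, hjl⟩ := exists_eq_ite_of_antitone hp.2.1 fun i => h1 _
  have hk := pos_of_ne_zero h0
  refine ⟨m, j, ?_, hm, ?_, ?_⟩
  · have := hml ⟨0, hk⟩
    rw [first_eq_one_of_mem_S hr hk] at this
    by_contra h
    rw [if_neg (by simpa using h)] at this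
    omega
  · by_contra h
    have := hp.2.2 ⟨m, by omega⟩
    rw [hml, hjl, if_neg (lt_irrefl m), if_pos (not_le.1 h)] at this
    omega
  · ext s
    rcases s with i | i
    · exact (hml i).symm
    · exact (hjl i).symm

theorem rename_collapse_rayFactor (R : Type*) [CommRing R] {k m j : ℕ} (hj : j ≤ k) :
    MvPolynomial.rename (collapse k) (rayFactor R (rayPoint k m j)) =
      1 - MvPolynomial.X (Sum.inr ()) ^ j *
        ∏ l ∈ Finset.univ.filter (fun l : Fin k => (l : ℕ) < m), MvPolynomial.X (Sum.inl l) := by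
  have h : (rayPoint k m j).mapDomain (collapse k) = Finsupp.single (Sum.inr ()) j +
      ∑ l ∈ Finset.univ.filter (fun l : Fin k => (l : ℕ) < m), Finsupp.single (Sum.inl l) 1 := by
    classical
    refine (mapDomain_collapse_eq_iff _ _).2 ⟨fun i => ?_, ?_⟩
    · simp [rayPoint_inl, Finsupp.single_apply]
    · simp only [rayPoint_inr]
      rw [sum_ite_val_lt hj]
      simp
  rw [map_sub, map_one, MvPolynomial.rename_monomial, h, MvPolynomial.X_pow_eq_monomial]
  simp only [MvPolynomial.X]
  rw [← MvPolynomial.monomial_sum_one, MvPolynomial.monomial_mul, one_mul]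

theorem rename_collapse_D (R : Type*) [CommRing R] (k : ℕ) :
    MvPolynomial.rename (collapse k) (D R k) = Dsingle R k := by
  rw [D, Dsingle, map_prod, Finset.prod_sigma']
  symm
  refine Finset.prod_bij (fun q _ => rayPoint k q.1 q.2) ?_ ?_ ?_ ?_
  · rintro ⟨m, j⟩ h
    simp only [Finset.mem_sigma, Finset.mem_Icc] at h
    simpa using rayPoint_mem_S h.1.1 h.1.2 h.2.2
  · rintro ⟨m, j⟩ h ⟨m', j'⟩ h' heq
    simp only [Finset.mem_sigma, Finset.mem_Icc] at h h'
    -- Both parameters are recovered from the point as its coordinate sums over λ and over μ.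
    have hl : m = m' := by
      rw [← sum_ite_val_lt h.1.2, ← sum_ite_val_lt h'.1.2]
      exact Finset.sum_congr rfl fun i _ => DFunLike.congr_fun heq (Sum.inl i)
    have hr : j = j' := by
      rw [← sum_ite_val_lt (h.2.2.trans h.1.2), ← sum_ite_val_lt (h'.2.2.trans h'.1.2)]
      exact Finset.sum_congr rfl fun i _ => DFunLike.congr_fun heq (Sum.inr i)
    rw [hl, hr]
  · intro r hr
    obtain ⟨m, j, h1, h2, h3, h4⟩ := exists_rayPoint_of_mem_S (by simpa using hr)
    exact ⟨⟨m, j⟩, by simp [h1, h2, h3], h4⟩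
  · rintro ⟨m, j⟩ h
    simp only [Finset.mem_sigma, Finset.mem_Icc] at h
    exact (rename_collapse_rayFactor R (h.2.2.trans h.1.2)).symm

theorem isDenominator_Qsingle (R : Type*) [CommRing R] (k : ℕ) :
    IsDenominator (Qsingle R k) (Dsingle R k) := by
  obtain ⟨N, hN⟩ := isDenominator_supportSeries R k fun s => ∀ i : Fin k, Sum.inl i ∈ s
  refine ⟨MvPolynomial.rename (collapse k) N, ?_⟩
  rw [← rename_collapse_Q, ← rename_collapse_D, ← MvPowerSeries.rename_coe,
    ← MvPowerSeries.rename_coe, ← map_mul, Q_eq_supportSeries, hN]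

end TwoRowPP

end

theorem mainTheorem3 {R : Type*} [CommRing R] [IsDomain R] [UniqueFactorizationMonoid R] (k : ℕ) :
    TwoRowPP.IsReducedDenominator (TwoRowPP.Qtilde R k) (TwoRowPP.D R k) ∧
    TwoRowPP.IsReducedDenominator (TwoRowPP.Q R k) (TwoRowPP.D R k) ∧
    MvPowerSeries.rename (TwoRowPP.collapse k) (TwoRowPP.Q R k) = TwoRowPP.Qsingle R k ∧
    MvPolynomial.rename (TwoRowPP.collapse k) (TwoRowPP.D R k) = TwoRowPP.Dsingle R k ∧
    ∃ N : MvPolynomial (Fin k ⊕ Unit) R,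
      TwoRowPP.Qsingle R k * (TwoRowPP.Dsingle R k : MvPowerSeries (Fin k ⊕ Unit) R) =
        (N : MvPowerSeries (Fin k ⊕ Unit) R) :=
  ⟨TwoRowPP.isReducedDenominator_Qtilde R k, TwoRowPP.isReducedDenominator_Q R k,
    TwoRowPP.rename_collapse_Q R k, TwoRowPP.rename_collapse_D R k,
    TwoRowPP.isDenominator_Qsingle R k⟩
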